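/- For a commutative ring $R$ and power series $g,f\in R[[x]]$, the Riordan array $(g,f)$ is the infinite matrix $(T_{n,k})_{n,k\ge 0}$ with $T_{n,k}=[x^n]\,g(x)f(x)^k$. For $r\in R$ let $M(r)$ be the inverse of the (unit lower triangular) Riordan array $$\left(\frac{1+rx^2}{1+x^2},\ \frac{x}{1+x^2}\right),$$ i.e. the moment matrix of the restricted Chebyshev–Boubaker polynomials. Let $s_n(r)=\sum_{k=0}^n M(r)_{n,k}$ be its row sums, and let $H_n(r)=\det\big(s_{i+j}(r)\big)_{0\le i,j\le n}$ be their Hankel transform. Let $U_n$ be the Chebyshev polynomials of the second kind. Then: 1. For every field $K$ of characteristic different from $2$, every nonzero $r\in K$ and every $n\ge 0$, $$H_n(r)=r^n\,U_n\!\left(\frac{\frac1r-1}{2}\right).$$ 2. $H_n(r)$ is the value at $r$ of a polynomial $H_n\in\mathbb Z[r]$ of degree at most $n$ (namely of $H_n(r)$ computed with $r$ an indeterminate), for every commutative ring $R$ and every $r\in R$. The reversed coefficient array of these polynomials, whose $(n,k)$ entry is $[r^{n-k}]H_n$ for $0\le k\le n$ and $0$ for $k>n$, is the Riordan array $$\left(\frac{1}{1+x+x^2},\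 \frac{x}{1+x+x^2}\right).$$ -/

import Mathlib

namespace ChebBoubaker

open PowerSeries in
/-- The Riordan array `(g, f)`: the infinite matrix with entries `T n k = [x^n] g(x) f(x)^k`. -/
noncomputable def riordan {R : Type*} [CommRing R] (g f : PowerSeries R) : Matrix ℕ ℕ R :=
  fun n k => coeff n (g * f ^ k)

/-- The inverse of an infinite lower triangular matrix with unit diagonal, computed by forward
substitution: it is the lower triangular matrix `L` with `L n n = 1` and
`∑ j ≤ n, T n j * L j k = 0` for `k < n`. See `isInverse_lowerInv`. -/
def lowerInv {R : Type*} [CommRing R] (T : Matrix ℕ ℕ R) (n k : ℕ) : R :=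
  (if n = k then 1 else 0) - ∑ j : Fin n, T n j * lowerInv T j k
termination_by n
decreasing_by exact j.2

/-- `T` and `L` are infinite lower triangular matrices, inverse to each other on both sides. Since
row `n` of a lower triangular matrix is supported on `0, …, n`, the products are finite sums. -/
structure IsInverse {R : Type*} [CommRing R] (T L : Matrix ℕ ℕ R) : Prop where
  lower_left : ∀ n k, n < k → T n k = 0
  lower_right : ∀ n k, n < k → L n k = 0
  mul_right : ∀ n k, ∑ j ∈ Finset.range (n + 1), T n j * L j k = if n = k then 1 else 0
  mul_left : ∀ n k, ∑ j ∈ Finset.range (n + 1), L n j * T j k = if n = k then 1 else 0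

theorem lowerInv_eq {R : Type*} [CommRing R] (T : Matrix ℕ ℕ R) (n k : ℕ) :
    lowerInv T n k = (if n = k then 1 else 0) - ∑ j ∈ Finset.range n, T n j * lowerInv T j k := by
  rw [lowerInv, Finset.sum_range]

theorem isInverse_lowerInv {R : Type*} [CommRing R] (T : Matrix ℕ ℕ R)
    (hlow : ∀ n k, n < k → T n k = 0) (hdiag : ∀ n, T n n = 1) : IsInverse T (lowerInv T) := by
  have hL : ∀ n k, n < k → lowerInv T n k = 0 := by
    intro n
    induction n using Nat.strong_induction_on with
    | _ n ih =>
      intro k hk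
      rw [lowerInv_eq, if_neg hk.ne, Finset.sum_eq_zero, sub_zero]
      intro j hj
      rw [ih j (Finset.mem_range.1 hj) k (lt_trans (Finset.mem_range.1 hj) hk), mul_zero]
  have hTL : ∀ n k, ∑ j ∈ Finset.range (n + 1), T n j * lowerInv T j k =
      if n = k then 1 else 0 := by
    intro n k
    rw [Finset.sum_range_succ, hdiag, one_mul, lowerInv_eq T n k]
    ring
  have ext : ∀ (A B : Matrix ℕ ℕ R), (∀ n k, n < k → A n k = 0) → ∀ (N n k : ℕ), n < N →
      ∑ j : Fin N, A n j * B j k = ∑ j ∈ Finset.range (n + 1), A n j * B j k := by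
    intro A B hA N n k hn
    rw [← Finset.sum_range (fun j => A n j * B j k)]
    symm
    apply Finset.sum_subset (Finset.range_subset_range.2 hn)
    intro j _ hj
    rw [hA n j (by simpa using hj), zero_mul]
  refine ⟨hlow, hL, hTL, fun n k => ?_⟩
  let N := n + k + 1
  let A : Matrix (Fin N) (Fin N) R := fun i j => T i j
  let B : Matrix (Fin N) (Fin N) R := fun i j => lowerInv T i j
  have h1 : A * B = 1 := by
    ext i j
    rw [Matrix.mul_apply, Matrix.one_apply]
    refine (ext T (lowerInv T) hlow N i j i.2).trans ((hTL i j).trans ?_)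
    simp [Fin.ext_iff]
  have h2 : B * A = 1 := mul_eq_one_comm.1 h1
  have h3 := congrFun (congrFun h2 ⟨n, by omega⟩) ⟨k, by omega⟩
  rw [Matrix.mul_apply, Matrix.one_apply] at h3
  rw [← ext (lowerInv T) T hL N n k (by omega)]
  refine h3.trans ?_
  simp [Fin.ext_iff]

open PowerSeries in
/-- The coefficient array of the restricted Chebyshev-Boubaker polynomials `P_n(x; r)`: the Riordan
array `((1 + r x^2) / (1 + x^2), x / (1 + x^2))`. -/
noncomputable def coeffArray {R : Type*} [CommRing R] (r : R) : Matrix ℕ ℕ R :=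
  riordan ((1 + C r * X ^ 2) * invOfUnit (1 + X ^ 2) 1) (X * invOfUnit (1 + X ^ 2) 1)

/-- The moment matrix `M(r)`, the inverse of the coefficient array. -/
noncomputable def momentMatrix {R : Type*} [CommRing R] (r : R) : Matrix ℕ ℕ R :=
  lowerInv (coeffArray r)

open PowerSeries in
theorem isInverse_momentMatrix {R : Type*} [CommRing R] (r : R) :
    IsInverse (coeffArray r) (momentMatrix r) := by
  have key : ∀ n k, coeffArray r n k = if k ≤ n then
      coeff (n - k) ((1 + C r * X ^ 2) * invOfUnit (1 + X ^ 2) 1 * invOfUnit (1 + X ^ 2) 1 ^ k)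
      else 0 := by
    intro n k
    rw [coeffArray, riordan, mul_pow, ← coeff_X_pow_mul']
    congr 1
    ring
  refine isInverse_lowerInv _ (fun n k h => ?_) (fun n => ?_)
  · rw [key, if_neg (by omega)]
  · rw [key, if_pos le_rfl, Nat.sub_self]
    simp

/-- The row sums `s_n(r)` of the (lower triangular) moment matrix. -/
noncomputable def rowSum {R : Type*} [CommRing R] (r : R) (n : ℕ) : R :=
  ∑ k ∈ Finset.range (n + 1), momentMatrix r n k

/-- The Hankel transform `h_n = det (a_{i+j})_{0 ≤ i, j ≤ n}` of a sequence. -/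
def hankelTransform {R : Type*} [CommRing R] (a : ℕ → R) (n : ℕ) : R :=
  Matrix.det (fun i j : Fin (n + 1) => a (i + j))

/-- `H_n(r)`, the Hankel transform of the row sums of the moment matrix. -/
noncomputable def rowSumHankel {R : Type*} [CommRing R] (r : R) (n : ℕ) : R :=
  hankelTransform (rowSum r) n

/-- `H_n(r)` with `r` an indeterminate: an element of `ℤ[r]`. -/
noncomputable def rowSumHankelPoly (n : ℕ) : Polynomial ℤ :=
  rowSumHankel (Polynomial.X : Polynomial ℤ) n

/-- The reversed coefficient array of a sequence of polynomials `p_n` with `deg p_n ≤ n`: row `n`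
is the list of the coefficients of `p_n` of degrees `n, n - 1, …, 0`, followed by zeros. -/
def reversedCoeffArray {R : Type*} [CommRing R] (p : ℕ → Polynomial R) : Matrix ℕ ℕ R :=
  fun n k => if k ≤ n then (p n).coeff (n - k) else 0

end ChebBoubaker

/-! Let `φ` be the linear functional with moments `s_n(r)`. Since the moment matrix inverts the
coefficient array of the polynomials `P_n`, its row sums are exactly the moments for which `φ(P_n) =
1` for every `n` (`momentFunctional_boubaker`). Hence `D_0 = 1`, `D_n = P_n - P_{n-1}` is a monic
basis with `φ(D_n) = 0` for `n ≥ 1`, and `H_n` is its Gram determinant (`det_gram_eq`).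

The Chebyshev recurrence of `P_n` passes to the `D_n` up to constants. As multiplication by `X` is
self-adjoint for `φ`, the Gram entries satisfy a discrete wave equation, whose solution with the
given boundary values is tridiagonal Toeplitz: `1 - r` on the diagonal, `r` beside it
(`gram_boubakerDiff`). Therefore `H_n = (1 - r) H_{n-1} - r² H_{n-2}` (`rowSumHankel_eq`). This is
the recurrence of `U_n` rescaled by `r^n`, and, read on coefficients, that of the Riordan array. -/

namespace ChebBoubaker

/-! ### Gram determinants of monic bases -/

section Gram

open Polynomial

variable {R : Type*} [CommRing R]

/-- The linear functional on polynomials with moments `s n`. -/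
noncomputable def momentFunctional (s : ℕ → R) : R[X] →ₗ[R] R :=
  Polynomial.lsum fun n => s n • LinearMap.id

theorem momentFunctional_monomial (s : ℕ → R) (n : ℕ) (a : R) :
    momentFunctional s (monomial n a) = s n * a := by
  simp [momentFunctional, Polynomial.lsum_apply]

theorem momentFunctional_X_pow (s : ℕ → R) (n : ℕ) : momentFunctional s (X ^ n) = s n := by
  rw [X_pow_eq_monomial, momentFunctional_monomial, mul_one]

/-- The Gram matrix of a monic basis has the same determinant as that of the powers of `X`. -/
theorem det_gram_eq (φ : R[X] →ₗ[R] R) (Q : ℕ → R[X]) (hdeg : ∀ i k, i < k → (Q i).coeff k = 0)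
    (hmonic : ∀ i, (Q i).coeff i = 1) (N : ℕ) :
    Matrix.det (Matrix.of fun i j : Fin N => φ (Q i * Q j)) =
      Matrix.det (Matrix.of fun i j : Fin N => φ (X ^ ((i : ℕ) + j))) := by
  let B : Matrix (Fin N) (Fin N) R := Matrix.of fun i j => (Q i).coeff j
  let S : Matrix (Fin N) (Fin N) R := Matrix.of fun i j => φ (X ^ ((i : ℕ) + j))
  have hB : B.det = 1 := by
    rw [Matrix.det_of_isLowerTriangular B (fun i j h => hdeg i j h)]
    exact Finset.prod_eq_one fun i _ => hmonic i
  have hQ : ∀ i : Fin N, Q i = ∑ a : Fin N, (Q i).coeff a • X ^ (a : ℕ) := by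
    intro i
    have hlt : (Q i).natDegree < N :=
      ((natDegree_le_iff_coeff_eq_zero).2 fun k hk => hdeg i k hk).trans_lt i.2
    conv_lhs => rw [(Q i).as_sum_range_C_mul_X_pow' hlt]
    rw [Finset.sum_range]
    simp only [smul_eq_C_mul]
  -- Change of basis for a bilinear form; `B` is unitriangular, so the determinant is unchanged.
  have hmul : Matrix.of (fun i j : Fin N => φ (Q i * Q j)) = B * S * B.transpose := by
    ext i j
    rw [Matrix.of_apply, hQ i, hQ j, Finset.sum_mul_sum, map_sum]
    simp only [Matrix.mul_apply, Finset.sum_mul, map_sum]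
    rw [Finset.sum_comm]
    refine Finset.sum_congr rfl fun b _ => Finset.sum_congr rfl fun a _ => ?_
    rw [smul_mul_smul_comm, ← pow_add, map_smul, smul_eq_mul]
    simp only [B, S, Matrix.of_apply, Matrix.transpose_apply]
    ring
  rw [hmul, Matrix.det_mul, Matrix.det_mul, Matrix.det_transpose, hB, one_mul, mul_one]

end Gram

/-! ### Tridiagonal Toeplitz determinants -/

section Tridiagonal

variable {R : Type*} [CommRing R]

/-- The entries of the symmetric tridiagonal Toeplitz matrix with diagonal `a`, off-diagonal `b`. -/
def tridiag (a b : R) (i j : ℕ) : R :=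
  if i = j then a else if i = j + 1 ∨ j = i + 1 then b else 0

theorem tridiag_succ_succ (a b : R) (i j : ℕ) :
    tridiag a b (i + 1) (j + 1) = tridiag a b i j := by
  simp [tridiag]

theorem tridiag_comm (a b : R) (i j : ℕ) : tridiag a b i j = tridiag a b j i := by
  simp only [tridiag, eq_comm (a := i) (b := j), or_comm]

/-- Laplace expansion along row 0, where only columns 0 and 1 contribute. The minor at `(0, 1)` has
first column `(b, 0, …, 0)`, which supplies the second factor `b`. -/
theorem det_tridiag_add_two (a b : R) (n : ℕ) :
    Matrix.det (Matrix.of fun i j : Fin (n + 2) => tridiag a b i j) =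
      a * Matrix.det (Matrix.of fun i j : Fin (n + 1) => tridiag a b i j) -
        b ^ 2 * Matrix.det (Matrix.of fun i j : Fin n => tridiag a b i j) := by
  have hminor : Matrix.det ((Matrix.of fun i j : Fin (n + 2) => tridiag a b i j).submatrix
      Fin.succ (Fin.succAbove 1)) =
        b * Matrix.det (Matrix.of fun i j : Fin n => tridiag a b i j) := by
    rw [Matrix.det_succ_column_zero, Fin.sum_univ_succ, Finset.sum_eq_zero]
    · simp only [Matrix.submatrix_apply, Matrix.of_apply, Matrix.submatrix_submatrix]
      have h : (Fin.succAbove (1 : Fin (n + 2)) 0) = 0 := rfl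
      have h' : (Matrix.of fun i j : Fin (n + 2) => tridiag a b i j).submatrix
          (Fin.succ ∘ Fin.succAbove 0) (Fin.succAbove 1 ∘ Fin.succ) =
            Matrix.of fun i j : Fin n => tridiag a b i j := by
        ext i j
        have hj : Fin.succAbove (1 : Fin (n + 2)) j.succ = j.succ.succ :=
          Fin.succAbove_of_lt_succ _ _ (by simp [Fin.lt_def])
        simp [hj, tridiag_succ_succ]
      rw [h, h']
      simp [tridiag]
    · intro i _
      have h : (Fin.succAbove (1 : Fin (n + 2)) 0) = 0 := rfl
      simp [h, tridiag]
  rw [Matrix.det_succ_row_zero, Fin.sum_univ_succ, Fin.sum_univ_succ, Finset.sum_eq_zero]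
  · have h0 : (Matrix.of fun i j : Fin (n + 2) => tridiag a b i j).submatrix
        Fin.succ (Fin.succAbove 0) = Matrix.of fun i j : Fin (n + 1) => tridiag a b i j := by
      ext i j
      simp [tridiag_succ_succ]
    rw [h0, show (Fin.succ (0 : Fin (n + 1))) = 1 from rfl, hminor]
    simp [tridiag]
    ring
  · intro i _
    simp [tridiag]

/-- The sequence `c 0 = 1`, `c 1 = 1 - r`, `c (n + 2) = (1 - r) c (n + 1) - r ^ 2 c n`. -/
def hankelRec (r : R) : ℕ → R
  | 0 => 1
  | 1 => 1 - r
  | n + 2 => (1 - r) * hankelRec r (n + 1) - r ^ 2 * hankelRec r n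

theorem det_tridiag (r : R) (n : ℕ) :
    Matrix.det (Matrix.of fun i j : Fin n => tridiag (1 - r) r i j) = hankelRec r n := by
  induction n using Nat.twoStepInduction with
  | zero => simp [hankelRec]
  | one => simp [hankelRec, tridiag]
  | more n ih0 ih1 => rw [det_tridiag_add_two, ih0, ih1, hankelRec]

end Tridiagonal

/-! ### The restricted Chebyshev-Boubaker polynomials -/

section Polynomials

variable {R : Type*} [CommRing R]

/-! ### Entry recurrences of the coefficient array -/

section Coefficients

open PowerSeries

/-- Links consecutive columns of a Riordan array. With `q = 1 + X ^ 2` or `q = 1 + X + X ^ 2`,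
comparing coefficients yields the entry recurrences of both arrays in the theorem. -/
theorem riordan_succ_mul (g u : PowerSeries R) (q : PowerSeries R) (h : q * u = 1) (k : ℕ) :
    q * (g * (X * u) ^ (k + 1)) = X * (g * (X * u) ^ k) := by
  linear_combination (g * (X * u) ^ k * X) * h

theorem coeffArray_zero_left (r : R) (k : ℕ) : coeffArray r 0 k = if k = 0 then 1 else 0 := by
  cases k with
  | zero => simp [coeffArray, riordan]
  | succ k => exact (isInverse_momentMatrix r).lower_left _ _ (by omega)

theorem coeffArray_one_zero (r : R) : coeffArray r 1 0 = 0 := by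
  have hu : (1 + X ^ 2 : PowerSeries R) * invOfUnit (1 + X ^ 2) 1 = 1 :=
    mul_invOfUnit _ _ (by simp)
  have h : (1 + X ^ 2 : PowerSeries R) * ((1 + C r * X ^ 2) * invOfUnit (1 + X ^ 2) 1) =
      1 + C r * X ^ 2 := by linear_combination (1 + C r * X ^ 2) * hu
  have := congrArg (coeff 1) h
  simpa [add_mul, coeff_X_pow_mul', coeff_one, coeff_X_pow, coeffArray, riordan] using this

/-- The numerator `1 + r x²` perturbs the Chebyshev recurrence only here, in column 0 of row 2. -/
theorem coeffArray_add_two_zero (r : R) (n : ℕ) :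
    coeffArray r (n + 2) 0 = (if n = 0 then r else 0) - coeffArray r n 0 := by
  have hu : (1 + X ^ 2 : PowerSeries R) * invOfUnit (1 + X ^ 2) 1 = 1 :=
    mul_invOfUnit _ _ (by simp)
  have h : (1 + X ^ 2 : PowerSeries R) * ((1 + C r * X ^ 2) * invOfUnit (1 + X ^ 2) 1) =
      1 + C r * X ^ 2 := by linear_combination (1 + C r * X ^ 2) * hu
  have := congrArg (coeff (n + 2)) h
  rw [add_mul, one_mul, map_add, coeff_X_pow_mul, map_add, coeff_C_mul, coeff_X_pow,
    coeff_one, if_neg (by omega), zero_add] at this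
  simp only [coeffArray, riordan, pow_zero, mul_one]
  rw [eq_sub_iff_add_eq, this]
  simp

theorem coeffArray_one_succ (r : R) (k : ℕ) : coeffArray r 1 (k + 1) = coeffArray r 0 k := by
  have h := congrArg (coeff 1) (riordan_succ_mul ((1 + C r * X ^ 2) * invOfUnit (1 + X ^ 2) 1)
    (invOfUnit (1 + X ^ 2) 1) (1 + X ^ 2) (mul_invOfUnit _ _ (by simp)) k)
  rw [add_mul, one_mul, map_add, coeff_X_pow_mul', if_neg (by omega), add_zero,
    coeff_succ_X_mul 0] at h
  exact h

theorem coeffArray_add_two_succ (r : R) (n k : ℕ) :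
    coeffArray r (n + 2) (k + 1) = coeffArray r (n + 1) k - coeffArray r n (k + 1) := by
  have h := congrArg (coeff (n + 2)) (riordan_succ_mul
    ((1 + C r * X ^ 2) * invOfUnit (1 + X ^ 2) 1)
    (invOfUnit (1 + X ^ 2) 1) (1 + X ^ 2) (mul_invOfUnit _ _ (by simp)) k)
  rw [add_mul, one_mul, map_add, coeff_X_pow_mul, coeff_succ_X_mul (n + 1)] at h
  exact eq_sub_of_add_eq h

end Coefficients

open Polynomial

/-- The restricted Chebyshev-Boubaker polynomial `P_n(x; r)`. -/
noncomputable def boubaker (r : R) (n : ℕ) : R[X] :=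
  ∑ k ∈ Finset.range (n + 1), monomial k (coeffArray r n k)

theorem coeff_boubaker (r : R) (n k : ℕ) : (boubaker r n).coeff k = coeffArray r n k := by
  rw [boubaker, finsetSum_coeff]
  simp only [coeff_monomial]
  rw [Finset.sum_ite_eq' (Finset.range (n + 1)) k]
  split_ifs with h
  · rfl
  · exact ((isInverse_momentMatrix r).lower_left _ _ (by simpa using h)).symm

theorem boubaker_zero (r : R) : boubaker r 0 = 1 := by
  ext k
  rw [coeff_boubaker, coeffArray_zero_left, coeff_one]

theorem boubaker_one (r : R) : boubaker r 1 = X := by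
  ext k
  rw [coeff_boubaker, coeff_X]
  cases k with
  | zero => simp [coeffArray_one_zero]
  | succ k => simp [coeffArray_one_succ, coeffArray_zero_left]

theorem boubaker_add_two (r : R) (n : ℕ) :
    boubaker r (n + 2) = X * boubaker r (n + 1) - boubaker r n + if n = 0 then C r else 0 := by
  ext k
  cases k with
  | zero =>
    rw [coeff_boubaker, coeffArray_add_two_zero]
    simp only [coeff_add, coeff_sub, mul_coeff_zero, coeff_X_zero, zero_mul, coeff_boubaker]
    split_ifs
    · simp
      ring
    · simp
  | succ k =>
    rw [coeff_boubaker, coeffArray_add_two_succ]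
    simp only [coeff_add, coeff_sub, coeff_X_mul, coeff_boubaker]
    split_ifs <;> simp

theorem coeffArray_self (r : R) (n : ℕ) : coeffArray r n n = 1 := by
  induction n with
  | zero => simp [coeffArray_zero_left]
  | succ n ih =>
    cases n with
    | zero => rw [coeffArray_one_succ, ih]
    | succ n =>
      rw [coeffArray_add_two_succ, ih,
        (isInverse_momentMatrix r).lower_left n (n + 2) (by omega), sub_zero]

/-- The row sums of the moment matrix are the moments of the functional taking the value `1` on
every `P_n`. -/
theorem momentFunctional_boubaker (r : R) (n : ℕ) :
    momentFunctional (rowSum r) (boubaker r n) = 1 := by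
  have hM := isInverse_momentMatrix r
  have hrow : ∀ j ∈ Finset.range (n + 1),
      rowSum r j = ∑ k ∈ Finset.range (n + 1), momentMatrix r j k := by
    intro j hj
    refine Finset.sum_subset (Finset.range_subset_range.2 (Finset.mem_range.1 hj)) ?_
    intro k _ hk
    exact hM.lower_right j k (by simpa using hk)
  calc momentFunctional (rowSum r) (boubaker r n)
      = ∑ j ∈ Finset.range (n + 1), rowSum r j * coeffArray r n j := by
        simp only [boubaker, map_sum, momentFunctional_monomial]
    _ = ∑ j ∈ Finset.range (n + 1), ∑ k ∈ Finset.range (n + 1),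
          coeffArray r n j * momentMatrix r j k := by
        refine Finset.sum_congr rfl fun j hj => ?_
        rw [hrow j hj, mul_comm, Finset.mul_sum]
    _ = ∑ k ∈ Finset.range (n + 1), if n = k then 1 else 0 := by
        rw [Finset.sum_comm]
        exact Finset.sum_congr rfl fun k _ => hM.mul_right n k
    _ = 1 := by simp

/-- The differences `P_n - P_{n-1}`, starting with `1`. -/
noncomputable def boubakerDiff (r : R) : ℕ → R[X]
  | 0 => 1
  | n + 1 => boubaker r (n + 1) - boubaker r n

theorem coeff_boubakerDiff_of_lt (r : R) (i k : ℕ) (h : i < k) :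
    (boubakerDiff r i).coeff k = 0 := by
  have hlow := (isInverse_momentMatrix r).lower_left
  cases i with
  | zero => rw [boubakerDiff, coeff_one, if_neg (by omega)]
  | succ i =>
    rw [boubakerDiff, coeff_sub, coeff_boubaker, coeff_boubaker, hlow _ _ h,
      hlow _ _ (by omega), sub_zero]

theorem coeff_boubakerDiff_self (r : R) (i : ℕ) : (boubakerDiff r i).coeff i = 1 := by
  cases i with
  | zero => simp [boubakerDiff]
  | succ i =>
    rw [boubakerDiff, coeff_sub, coeff_boubaker, coeff_boubaker, coeffArray_self,
      (isInverse_momentMatrix r).lower_left _ _ (by omega), sub_zero]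

theorem boubakerDiff_one (r : R) : boubakerDiff r 1 = X - 1 := by
  rw [boubakerDiff, boubaker_one, boubaker_zero]

/-- The constant `1 - r` becomes the diagonal entry of the Gram matrix, since `φ` kills `D_2`. -/
theorem X_mul_boubakerDiff_one (r : R) :
    X * boubakerDiff r 1 = boubakerDiff r 2 + (1 - r) • 1 := by
  simp only [boubakerDiff, boubaker_add_two, boubaker_one, boubaker_zero, smul_eq_C_mul]
  simp
  ring

/-- The only defect is the constant `r` at `n = 0`, which becomes the off-diagonal Gram entry. -/
theorem X_mul_boubakerDiff_add_two (r : R) (n : ℕ) :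
    X * boubakerDiff r (n + 2) =
      boubakerDiff r (n + 3) + boubakerDiff r (n + 1) + (if n = 0 then r else 0) • 1 := by
  simp only [boubakerDiff, boubaker_add_two, smul_eq_C_mul]
  split_ifs <;> simp_all <;> ring

theorem momentFunctional_boubakerDiff_succ (r : R) (n : ℕ) :
    momentFunctional (rowSum r) (boubakerDiff r (n + 1)) = 0 := by
  rw [boubakerDiff, map_sub, momentFunctional_boubaker, momentFunctional_boubaker, sub_self]

theorem momentFunctional_one (r : R) : momentFunctional (rowSum r) 1 = 1 := by
  rw [← boubaker_zero r, momentFunctional_boubaker]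

/-- The Gram matrix of the differences `P_n - P_{n-1}`, `n ≥ 1`, is tridiagonal. -/
theorem gram_boubakerDiff (r : R) (i j : ℕ) :
    momentFunctional (rowSum r) (boubakerDiff r (i + 1) * boubakerDiff r (j + 1)) =
      tridiag (1 - r) r i j := by
  set φ := momentFunctional (rowSum r) with hφ
  have h0 : ∀ n, φ (boubakerDiff r (n + 1)) = 0 := momentFunctional_boubakerDiff_succ r
  have h1 : φ 1 = 1 := momentFunctional_one r
  -- As `D_1 = X - 1` and `φ(D_{j+1}) = 0`, this is `φ(X D_{j+1})`, the constant term in the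
  -- recurrence.
  have first : ∀ j, φ (boubakerDiff r 1 * boubakerDiff r (j + 1)) = tridiag (1 - r) r 0 j := by
    intro j
    rw [boubakerDiff_one, sub_mul, one_mul, map_sub, h0, sub_zero]
    cases j with
    | zero => rw [X_mul_boubakerDiff_one, map_add, h0, map_smul, h1]; simp [tridiag]
    | succ j =>
      rw [X_mul_boubakerDiff_add_two, map_add, map_add, h0, h0, map_smul, h1]
      simp [tridiag]
  -- Both this and `wave` expand `φ(X D_a D_b)` by applying the recurrence to either factor;
  -- constant defects multiply a single `D_m` with `m ≥ 1`, which `φ` kills. Here `X D_1` has no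
  -- lower neighbour, so a term is missing.
  have second : ∀ j, φ (boubakerDiff r 2 * boubakerDiff r (j + 2)) =
      φ (boubakerDiff r 1 * boubakerDiff r (j + 3)) +
        φ (boubakerDiff r 1 * boubakerDiff r (j + 1)) := by
    intro j
    have e : boubakerDiff r 2 * boubakerDiff r (j + 2) =
        boubakerDiff r 1 * boubakerDiff r (j + 3) + boubakerDiff r 1 * boubakerDiff r (j + 1) +
        (if j = 0 then r else 0) • boubakerDiff r 1 - (1 - r) • boubakerDiff r (j + 2) := by
      have e1 := X_mul_boubakerDiff_one r
      have e2 := X_mul_boubakerDiff_add_two r j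
      rw [smul_eq_C_mul] at *
      rw [smul_eq_C_mul]
      linear_combination boubakerDiff r 1 * e2 - boubakerDiff r (j + 2) * e1
    rw [e, map_sub, map_add, map_add, map_smul, map_smul, h0, h0, smul_zero, smul_zero,
      sub_zero, add_zero]
  have wave : ∀ i j, φ (boubakerDiff r (i + 3) * boubakerDiff r (j + 2)) =
      φ (boubakerDiff r (i + 2) * boubakerDiff r (j + 3)) +
        φ (boubakerDiff r (i + 2) * boubakerDiff r (j + 1)) -
        φ (boubakerDiff r (i + 1) * boubakerDiff r (j + 2)) := by
    intro i j
    have e : boubakerDiff r (i + 3) * boubakerDiff r (j + 2) =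
        boubakerDiff r (i + 2) * boubakerDiff r (j + 3) +
        boubakerDiff r (i + 2) * boubakerDiff r (j + 1) -
        boubakerDiff r (i + 1) * boubakerDiff r (j + 2) +
        (if j = 0 then r else 0) • boubakerDiff r (i + 2) -
        (if i = 0 then r else 0) • boubakerDiff r (j + 2) := by
      have e1 := X_mul_boubakerDiff_add_two r i
      have e2 := X_mul_boubakerDiff_add_two r j
      rw [smul_eq_C_mul] at *
      rw [smul_eq_C_mul]
      linear_combination boubakerDiff r (i + 2) * e2 - boubakerDiff r (j + 2) * e1
    rw [e, map_sub, map_add, map_sub, map_add, map_smul, map_smul, h0, h0, smul_zero, smul_zero,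
      sub_zero, add_zero]
  induction i using Nat.twoStepInduction generalizing j with
  | zero => exact first j
  | one =>
    cases j with
    | zero => rw [mul_comm, first, tridiag_comm]
    | succ j =>
      rw [second, first (j + 2), first j]
      rw [tridiag_succ_succ, tridiag, if_neg (by omega), if_neg (by omega), zero_add]
  | more i ih0 ih1 =>
    cases j with
    | zero => rw [mul_comm, first, tridiag_comm]
    | succ j =>
      rw [wave, ih1 (j + 2), ih1 j, ih0 (j + 1)]
      -- A function of `i - j` satisfies the wave equation: the terms pair off along diagonals.
      simp only [tridiag]
      split_ifs <;> first | omega | simp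

/-- Row 0 of the Gram matrix is `(1, 0, …, 0)`, so the determinant of size `n + 1` drops to the
tridiagonal one of size `n`. -/
theorem rowSumHankel_eq (r : R) (n : ℕ) : rowSumHankel r n = hankelRec r n := by
  have hgram := det_gram_eq (momentFunctional (rowSum r)) (boubakerDiff r)
    (coeff_boubakerDiff_of_lt r) (coeff_boubakerDiff_self r) (n + 1)
  simp only [momentFunctional_X_pow] at hgram
  have hH : rowSumHankel r n =
      Matrix.det (Matrix.of fun i j : Fin (n + 1) => rowSum r ((i : ℕ) + j)) := rfl
  rw [hH, ← hgram, Matrix.det_succ_row_zero, Fin.sum_univ_succ, Finset.sum_eq_zero, add_zero,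
    ← det_tridiag]
  · have hsub : (Matrix.of fun i j : Fin (n + 1) => momentFunctional (rowSum r)
        (boubakerDiff r i * boubakerDiff r j)).submatrix Fin.succ (Fin.succAbove 0) =
          Matrix.of fun i j : Fin n => tridiag (1 - r) r i j := by
      ext i j
      simp [gram_boubakerDiff]
    rw [hsub]
    simp [boubakerDiff, momentFunctional_one]
  · intro j _
    have hj : momentFunctional (rowSum r)
        (boubakerDiff r 0 * boubakerDiff r ((j : ℕ) + 1)) = 0 := by
      rw [show boubakerDiff r 0 = 1 from rfl, one_mul, momentFunctional_boubakerDiff_succ]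
    simp [hj]

end Polynomials

/-! ### The Hankel transform -/

section Hankel

open Polynomial

/-- With `2x = 1/r - 1`, the recurrence `U_{n+2} = 2x U_{n+1} - U_n` multiplied by `r^{n+2}` has
coefficients `2xr = 1 - r` and `r²`. -/
theorem hankelRec_eq_chebyshev {K : Type*} [Field K] (h2 : (2 : K) ≠ 0) (r : K) (hr : r ≠ 0)
    (n : ℕ) :
    hankelRec r n = r ^ n * (Polynomial.Chebyshev.U K (n : ℤ)).eval ((1 / r - 1) / 2) := by
  induction n using Nat.twoStepInduction with
  | zero => simp [hankelRec]
  | one => simp [hankelRec]; field_simp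
  | more n ih0 ih1 =>
    rw [hankelRec, ih0, ih1]
    push_cast
    rw [Polynomial.Chebyshev.U_add_two]
    simp only [eval_sub, eval_mul, eval_X, eval_ofNat]
    field_simp
    ring

/-- Allows specialising the indeterminate without transporting the moment matrix along a ring map.
-/
theorem map_hankelRec {R S : Type*} [CommRing R] [CommRing S] (f : R →+* S) (r : R) (n : ℕ) :
    f (hankelRec r n) = hankelRec (f r) n := by
  induction n using Nat.twoStepInduction with
  | zero => simp [hankelRec]
  | one => simp [hankelRec]
  | more n ih0 ih1 => simp [hankelRec, ih0, ih1]

theorem rowSumHankelPoly_eq (n : ℕ) : rowSumHankelPoly n = hankelRec (X : ℤ[X]) n :=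
  rowSumHankel_eq _ n

theorem natDegree_hankelRec_X_le (n : ℕ) : (hankelRec (X : ℤ[X]) n).natDegree ≤ n := by
  induction n using Nat.twoStepInduction with
  | zero => simp [hankelRec]
  | one => rw [hankelRec]; compute_degree
  | more n ih0 ih1 =>
    rw [hankelRec]
    refine (natDegree_sub_le _ _).trans (max_le ?_ ?_)
    · refine (natDegree_mul_le_of_le (m := 1) ?_ ih1).trans (by omega)
      compute_degree
    · exact (natDegree_mul_le_of_le (natDegree_X_pow_le 2) ih0).trans (by omega)

theorem reversedCoeffArray_zero_left (k : ℕ) :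
    reversedCoeffArray (hankelRec (X : ℤ[X])) 0 k = if k = 0 then 1 else 0 := by
  simp [reversedCoeffArray, hankelRec]

theorem coeff_hankelRec_X_add_two (n m : ℕ) :
    (hankelRec (X : ℤ[X]) (n + 2)).coeff (m + 2) =
      (hankelRec (X : ℤ[X]) (n + 1)).coeff (m + 2) - (hankelRec (X : ℤ[X]) (n + 1)).coeff (m + 1) -
        (hankelRec (X : ℤ[X]) n).coeff m := by
  rw [hankelRec, sub_mul, one_mul, coeff_sub, coeff_sub, coeff_X_mul, coeff_X_pow_mul]

theorem coeff_hankelRec_X_one (n : ℕ) :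
    (hankelRec (X : ℤ[X]) (n + 2)).coeff 1 =
      (hankelRec (X : ℤ[X]) (n + 1)).coeff 1 - (hankelRec (X : ℤ[X]) (n + 1)).coeff 0 := by
  rw [hankelRec, sub_mul, one_mul, coeff_sub, coeff_sub, coeff_X_mul, coeff_X_pow_mul']
  simp

theorem coeff_hankelRec_X_zero (n : ℕ) :
    (hankelRec (X : ℤ[X]) (n + 2)).coeff 0 = (hankelRec (X : ℤ[X]) (n + 1)).coeff 0 := by
  simp [hankelRec]

theorem reversedCoeffArray_add_two_zero (n : ℕ) :
    reversedCoeffArray (hankelRec (X : ℤ[X])) (n + 2) 0 =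
      -reversedCoeffArray (hankelRec (X : ℤ[X])) (n + 1) 0 -
        reversedCoeffArray (hankelRec (X : ℤ[X])) n 0 := by
  simp only [reversedCoeffArray, Nat.zero_le, if_true, Nat.sub_zero]
  -- The term `[r^{n+2}]` of the polynomial of index `n + 1` vanishes for degree reasons.
  rw [coeff_hankelRec_X_add_two, coeff_eq_zero_of_natDegree_lt
    ((natDegree_hankelRec_X_le (n + 1)).trans_lt (by omega))]
  ring

/-- In the reversed indexing, the term `c_{n+1}` of the recurrence shifts the column, whereas `r
c_{n+1}` and `r² c_n` keep it. -/
theorem reversedCoeffArray_add_two_succ (n k : ℕ) :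
    reversedCoeffArray (hankelRec (X : ℤ[X])) (n + 2) (k + 1) =
      reversedCoeffArray (hankelRec (X : ℤ[X])) (n + 1) k -
        reversedCoeffArray (hankelRec (X : ℤ[X])) (n + 1) (k + 1) -
        reversedCoeffArray (hankelRec (X : ℤ[X])) n (k + 1) := by
  simp only [reversedCoeffArray]
  -- The exponent `n - (k + 1)` is genuine only for `k < n`; otherwise the entry in row `n` is zero
  -- by definition.
  rcases lt_trichotomy k n with h | rfl | h
  · obtain ⟨m, rfl⟩ := Nat.exists_eq_add_of_lt h
    rw [if_pos (by omega), if_pos (by omega), if_pos (by omega), if_pos (by omega),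
      show k + m + 1 + 2 - (k + 1) = m + 2 by omega, show k + m + 1 + 1 - k = m + 2 by omega,
      show k + m + 1 + 1 - (k + 1) = m + 1 by omega, show k + m + 1 - (k + 1) = m by omega,
      coeff_hankelRec_X_add_two]
  · rw [if_pos (by omega), if_pos (by omega), if_pos (by omega), if_neg (by omega),
      show k + 2 - (k + 1) = 1 by omega, show k + 1 - k = 1 by omega, Nat.sub_self,
      coeff_hankelRec_X_one, sub_zero]
  · by_cases hk : k = n + 1
    · subst hk
      simp [coeff_hankelRec_X_zero]
    · simp [show ¬ k ≤ n + 1 by omega, show ¬ k ≤ n by omega, show ¬ k + 1 ≤ n by omega]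

end Hankel

/-! ### Identification of the reversed array with a Riordan array -/

section Riordan

open PowerSeries

/-- Both arrays obey the same two-step recurrence in `n` and agree in rows 0 and 1. -/
theorem reversedCoeffArray_hankelRec :
    reversedCoeffArray (hankelRec (Polynomial.X : Polynomial ℤ)) =
      riordan (invOfUnit (1 + X + X ^ 2) 1 : PowerSeries ℤ)
        (X * invOfUnit (1 + X + X ^ 2) 1) := by
  set u : PowerSeries ℤ := invOfUnit (1 + X + X ^ 2) 1 with hu_def
  have hu : (1 + X + X ^ 2 : PowerSeries ℤ) * u = 1 := mul_invOfUnit _ _ (by simp)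
  have hu0 : coeff 0 u = 1 := by simp [hu_def]
  have hu1 : coeff 1 u = -1 := by
    have h := congrArg (coeff 1) hu
    rw [add_mul, add_mul, one_mul, map_add, map_add, coeff_X_pow_mul', coeff_succ_X_mul 0, hu0,
      coeff_one] at h
    simp at h
    linarith
  have hz : ∀ n, riordan u (X * u) (n + 2) 0 =
      -riordan u (X * u) (n + 1) 0 - riordan u (X * u) n 0 := by
    intro n
    have h := congrArg (coeff (n + 2)) hu
    rw [add_mul, add_mul, one_mul, map_add, map_add, coeff_X_pow_mul, coeff_succ_X_mul (n + 1),
      coeff_one, if_neg (by omega)] at h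
    simp only [riordan, pow_zero, mul_one]
    linarith
  have hs : ∀ n k, riordan u (X * u) (n + 2) (k + 1) = riordan u (X * u) (n + 1) k -
      riordan u (X * u) (n + 1) (k + 1) - riordan u (X * u) n (k + 1) := by
    intro n k
    have h := congrArg (coeff (n + 2)) (riordan_succ_mul u u (1 + X + X ^ 2) hu k)
    rw [add_mul, add_mul, one_mul, map_add, map_add, coeff_X_pow_mul, coeff_succ_X_mul (n + 1),
      coeff_succ_X_mul (n + 1)] at h
    simp only [riordan]
    linarith
  have hzero : ∀ k, riordan u (X * u) 0 k = if k = 0 then 1 else 0 := by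
    intro k
    cases k with
    | zero => simpa [riordan] using hu0
    | succ k => simp [riordan]
  have hone : ∀ k, riordan u (X * u) 1 (k + 1) = riordan u (X * u) 0 k -
      riordan u (X * u) 0 (k + 1) := by
    intro k
    have h := congrArg (coeff 1) (riordan_succ_mul u u (1 + X + X ^ 2) hu k)
    rw [add_mul, add_mul, one_mul, map_add, map_add, coeff_X_pow_mul', coeff_succ_X_mul 0,
      coeff_succ_X_mul 0, if_neg (by omega)] at h
    simp only [riordan]
    linarith
  ext n k
  induction n using Nat.twoStepInduction generalizing k with
  | zero => rw [reversedCoeffArray_zero_left, hzero]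
  | one =>
    cases k with
    | zero =>
      simp [reversedCoeffArray, hankelRec, riordan, hu1, Polynomial.coeff_one]
    | succ k =>
      rw [hone, hzero, hzero]
      cases k <;> simp [reversedCoeffArray, hankelRec]
  | more n ih0 ih1 =>
    cases k with
    | zero => rw [reversedCoeffArray_add_two_zero, hz, ih0, ih1]
    | succ k => rw [reversedCoeffArray_add_two_succ, hs, ih0, ih1, ih1]

end Riordan

end ChebBoubaker

theorem mainTheorem2 :
    -- the closed form, for every nonzero value of the parameter
    (∀ (K : Type*) [Field K], (2 : K) ≠ 0 → ∀ r : K, r ≠ 0 → ∀ n : ℕ,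
      ChebBoubaker.rowSumHankel r n =
        r ^ n * (Polynomial.Chebyshev.U K (n : ℤ)).eval ((1 / r - 1) / 2)) ∧
    -- `H_n(r)` is the value at `r` of one integer polynomial of degree at most `n`
    (∀ (R : Type*) [CommRing R] (r : R) (n : ℕ),
      ChebBoubaker.rowSumHankel r n =
        Polynomial.aeval r (ChebBoubaker.rowSumHankelPoly n)) ∧
    (∀ n : ℕ, (ChebBoubaker.rowSumHankelPoly n).natDegree ≤ n) ∧
    -- the reversed coefficient array is the Riordan array `(1/(1+x+x²), x/(1+x+x²))`
    ChebBoubaker.reversedCoeffArray ChebBoubaker.rowSumHankelPoly =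
      ChebBoubaker.riordan
        (PowerSeries.invOfUnit (1 + PowerSeries.X + PowerSeries.X ^ 2) 1 : PowerSeries ℤ)
        (PowerSeries.X * PowerSeries.invOfUnit (1 + PowerSeries.X + PowerSeries.X ^ 2) 1) := by
  refine ⟨fun K _ h2 r hr n => ?_, fun R _ r n => ?_, fun n => ?_, ?_⟩
  · rw [ChebBoubaker.rowSumHankel_eq, ChebBoubaker.hankelRec_eq_chebyshev h2 r hr]
  · rw [ChebBoubaker.rowSumHankel_eq, ChebBoubaker.rowSumHankelPoly_eq]
    have h := ChebBoubaker.map_hankelRec (Polynomial.aeval r : Polynomial ℤ →ₐ[ℤ] R).toRingHom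
      Polynomial.X n
    simpa using h.symm
  · rw [ChebBoubaker.rowSumHankelPoly_eq]
    exact ChebBoubaker.natDegree_hankelRec_X_le n
  · rw [funext ChebBoubaker.rowSumHankelPoly_eq, ChebBoubaker.reversedCoeffArray_hankelRec]
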